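/- Let $a<b$, let $L^2=L^2(a,b)$ be the space of real square-integrable functions with inner product $(\cdot,\cdot)$ and norm $\|\cdot\|$, and let $\partial$ be the (weak) derivative. Let $K$ be the integral operator $Kf(x)=\int_a^b K(x,y)f(y)\,dy$ on $L^2$ with a real kernel that is square-integrable on $(a,b)^2$ (for example continuous or bounded piecewise continuous), and let $K^*$ be its adjoint. Let $B$ be the closed unit ball of $L^2$ and put $$A^0=\{u\in B: u\perp\ker K^*\},\quad A^0_*=\{u\in B: u\perp\ker K\},\quad A^1=A=K(B),\quad A^1_*=A_*=K^*(B),$$ $$A^r=K(A_*^{r-1}),\quad A_*^r=K^*(A^{r-1})\qquad (r\ge 2).$$ Assume that $\partial Kf=f$ for all $f\in A_*^r$ and $\partial K^*g=-g$ for all $g\in A^r$, for all $r\ge 0$. For a finite-dimensional subspace $\mathbb X\subset L^2$ with $L^2$-orthogonal projector $X$ and a set $S\subset L^2$, let $E(S,\mathbb X)=\sup_{u\in S}\|u-Xu\|$, and let $d_n(S)=\inf_{\dim\mathbb X=n}E(S,\mathbb X)$ be the Kolmogorov $n$-width; $\mathbb X$ is called optimal for the $n$-width of $S$ if $\dim\mathbb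 X\le n$ and $E(S,\mathbb X)=d_n(S)$. Let $\mathbb X_0,\mathbb Y_0$ be finite-dimensional subspaces of $L^2$ with $\mathbb X_0\perp\ker K^*$ and $\mathbb Y_0\perp\ker K$, and set $\mathbb X_p=K(\mathbb Y_{p-1})$, $\mathbb Y_p=K^*(\mathbb X_{p-1})$ for $p\ge 1$. Let $\mu_l$ be the $l$-th eigenvalue of the problem: find $\psi\in K(L^2)$, $\mu\in\mathbb R$ with $$(\partial\psi,\partial v)=\mu(\psi,v)\quad\forall v\in K(L^2),$$ and let $\mu_{p,l}$ be the $l$-th eigenvalue of the Galerkin problem: find $\psi_p\in\mathbb X_p$, $\mu_p\in\mathbb R$ with $$(\partial\psi_p,\partial v)=\mu_p(\psi_p,v)\quad\forall v\in\mathbb X_p,$$ the eigenvalues being listed increasingly and repeated according to multiplicity. Assume that $\mu_1,\dots,\mu_{n+1}$ exist and that $\mu_1\le\dots\le\mu_n<\mu_{n+1}$. If $\mathbb X_0$ is optimal for the $n$-width of $A$ and $\mathbb Y_0$ is optimal for the $n$-width of $A_*$, then for every $p\ge 1$ and every $l=1,\dots,n$ the eigenvalue $\mu_{p,l}$ exists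 and $$\mu_l\le\mu_{p,l}\le\frac{\mu_l}{\left(1-\left(\frac{\mu_l}{\mu_{n+1}}\right)^{(p+1)/2}\right)^2}.$$ -/

import Mathlib

open MeasureTheory
open scoped ENNReal ContDiff InnerProductSpace

noncomputable section

namespace OutlierFree

/-- Lebesgue measure on the interval `(a, b)`. -/
abbrev intervalMeasure (a b : ℝ) : Measure ℝ := volume.restrict (Set.Ioo a b)

/-- The real Hilbert space `L²(a, b)`. -/
abbrev L2 (a b : ℝ) : Type := Lp ℝ 2 (intervalMeasure a b)

/-! ### Integral operators -/

section Kernel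

variable {a b : ℝ} {k : ℝ → ℝ → ℝ}

/-- The kernel `k` is square integrable on `(a, b) × (a, b)`.  Every continuous, and every
(bounded) piecewise continuous kernel has this property. -/
def IsL2Kernel (a b : ℝ) (k : ℝ → ℝ → ℝ) : Prop :=
  MemLp (Function.uncurry k) 2 ((intervalMeasure a b).prod (intervalMeasure a b))

lemma IsL2Kernel.integrable_sq (hk : IsL2Kernel a b k) :
    Integrable (fun z : ℝ × ℝ => k z.1 z.2 ^ 2)
      ((intervalMeasure a b).prod (intervalMeasure a b)) :=
  MemLp.integrable_sq hk

lemma IsL2Kernel.ae_memLp (hk : IsL2Kernel a b k) :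
    ∀ᵐ x ∂(intervalMeasure a b), MemLp (fun y => k x y) 2 (intervalMeasure a b) := by
  filter_upwards [hk.integrable_sq.prod_right_ae, hk.1.prodMk_left] with x h1 h2
  exact (memLp_two_iff_integrable_sq h2).2 h1

lemma sq_integral_mul_le {g : ℝ → ℝ} (hg : MemLp g 2 (intervalMeasure a b)) (f : L2 a b) :
    (∫ y, g y * f y ∂(intervalMeasure a b)) ^ 2 ≤
      (∫ y, g y ^ 2 ∂(intervalMeasure a b)) * ‖f‖ ^ 2 := by
  have h1 : ∫ y, g y * f y ∂(intervalMeasure a b) = ⟪hg.toLp g, f⟫_ℝ := by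
    rw [L2.inner_def]
    apply integral_congr_ae
    filter_upwards [hg.coeFn_toLp] with y hy
    simp [hy, mul_comm]
  have h2 : ∫ y, g y ^ 2 ∂(intervalMeasure a b) = ‖hg.toLp g‖ ^ 2 := by
    rw [← real_inner_self_eq_norm_sq, L2.inner_def]
    apply integral_congr_ae
    filter_upwards [hg.coeFn_toLp] with y hy
    simp [hy, sq]
  rw [h1, h2, ← mul_pow, ← sq_abs]
  exact pow_le_pow_left₀ (abs_nonneg _) (abs_real_inner_le_norm _ _) 2

lemma IsL2Kernel.aestronglyMeasurable (hk : IsL2Kernel a b k) (f : L2 a b) :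
    AEStronglyMeasurable (fun x => ∫ y, k x y * f y ∂(intervalMeasure a b))
      (intervalMeasure a b) := by
  have h : AEStronglyMeasurable (fun z : ℝ × ℝ => k z.1 z.2 * f z.2)
      ((intervalMeasure a b).prod (intervalMeasure a b)) :=
    hk.1.mul (Lp.aestronglyMeasurable f).comp_snd
  exact h.integral_prod_right'

lemma IsL2Kernel.sq_le (hk : IsL2Kernel a b k) (f : L2 a b) :
    ∀ᵐ x ∂(intervalMeasure a b), (∫ y, k x y * f y ∂(intervalMeasure a b)) ^ 2 ≤
      (∫ y, k x y ^ 2 ∂(intervalMeasure a b)) * ‖f‖ ^ 2 := by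
  filter_upwards [hk.ae_memLp] with x hx using sq_integral_mul_le hx f

lemma IsL2Kernel.memLp_integral (hk : IsL2Kernel a b k) (f : L2 a b) :
    MemLp (fun x => ∫ y, k x y * f y ∂(intervalMeasure a b)) 2 (intervalMeasure a b) := by
  rw [memLp_two_iff_integrable_sq (hk.aestronglyMeasurable f)]
  refine (hk.integrable_sq.integral_prod_left.mul_const (‖f‖ ^ 2)).mono'
    ((hk.aestronglyMeasurable f).pow 2) ?_
  filter_upwards [hk.sq_le f] with x hx
  rw [Real.norm_of_nonneg (sq_nonneg _)]
  exact hx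

lemma IsL2Kernel.norm_toLp_le (hk : IsL2Kernel a b k) (f : L2 a b) :
    ‖(hk.memLp_integral f).toLp _‖ ≤
      √(∫ x, ∫ y, k x y ^ 2 ∂(intervalMeasure a b) ∂(intervalMeasure a b)) * ‖f‖ := by
  have hC : 0 ≤ ∫ x, ∫ y, k x y ^ 2 ∂(intervalMeasure a b) ∂(intervalMeasure a b) :=
    integral_nonneg fun x => integral_nonneg fun y => sq_nonneg _
  refine abs_le_of_sq_le_sq' ?_ (by positivity) |>.2
  rw [mul_pow, Real.sq_sqrt hC, ← integral_mul_const, ← real_inner_self_eq_norm_sq,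
    L2.inner_def]
  have h2 := (memLp_two_iff_integrable_sq (hk.aestronglyMeasurable f)).1 (hk.memLp_integral f)
  calc _ = ∫ x, (∫ y, k x y * f y ∂(intervalMeasure a b)) ^ 2 ∂(intervalMeasure a b) := by
        apply integral_congr_ae
        filter_upwards [(hk.memLp_integral f).coeFn_toLp] with x hx
        simp [hx, sq]
    _ ≤ _ := integral_mono_ae h2
        (hk.integrable_sq.integral_prod_left.mul_const (‖f‖ ^ 2)) (hk.sq_le f)

/-- The integral operator `K f (x) = ∫_a^b k(x, y) f(y) dy` on `L²(a, b)`. -/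
def integralOperator (k : ℝ → ℝ → ℝ) (hk : IsL2Kernel a b k) : L2 a b →L[ℝ] L2 a b :=
  LinearMap.mkContinuous
    { toFun := fun f =>
        (hk.memLp_integral f).toLp (fun x => ∫ y, k x y * f y ∂(intervalMeasure a b))
      map_add' := fun f g => by
        rw [← MemLp.toLp_add, MemLp.toLp_eq_toLp_iff]
        filter_upwards [hk.ae_memLp] with x hx
        have e := integral_add (hx.integrable_mul (Lp.memLp f)) (hx.integrable_mul (Lp.memLp g))
        simp only [Pi.mul_apply] at e
        rw [Pi.add_apply, ← e]
        apply integral_congr_ae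
        filter_upwards [Lp.coeFn_add f g] with y hy
        rw [hy, Pi.add_apply, mul_add]
      map_smul' := fun c f => by
        rw [RingHom.id_apply, ← MemLp.toLp_const_smul, MemLp.toLp_eq_toLp_iff]
        refine Filter.Eventually.of_forall fun x => ?_
        simp only [Pi.smul_apply, smul_eq_mul]
        rw [← integral_const_mul]
        apply integral_congr_ae
        filter_upwards [Lp.coeFn_smul c f] with y hy
        rw [hy, Pi.smul_apply, smul_eq_mul]
        ring }
    (√(∫ x, ∫ y, k x y ^ 2 ∂(intervalMeasure a b) ∂(intervalMeasure a b)))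
    hk.norm_toLp_le

end Kernel

section Abstract

variable {a b : ℝ}

/-! ### Function classes and the associated subspaces -/

/-- The classes `A^r` of the operator `K`, where `B` is the closed unit ball of `L²(a, b)`:
`A^0 = {u ∈ B : u ⟂ ker K*}`, `A^1 = K(B)`, `A^r = K(A_*^{r-1})` for `r ≥ 2`.
The classes `A_*^r` are those of the adjoint `K*`, that is, `functionClass K† r`. -/
def functionClass (K : L2 a b →L[ℝ] L2 a b) : ℕ → Set (L2 a b)
  | 0 => {u | ‖u‖ ≤ 1 ∧ u ∈ ((ContinuousLinearMap.adjoint K).ker)ᗮ}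
  | 1 => K '' Metric.closedBall 0 1
  | r + 2 => K '' functionClass (ContinuousLinearMap.adjoint K) (r + 1)

/-- The spaces `𝕏_p`: `𝕏_0 = X₀`, `𝕏_p = K(𝕐_{p-1})`, where `𝕐_0 = Y₀`, `𝕐_p = K*(𝕏_{p-1})`.
The spaces `𝕐_p` are `galerkinSpace K† Y₀ X₀ p`. -/
def galerkinSpace (K : L2 a b →L[ℝ] L2 a b) (X₀ Y₀ : Submodule ℝ (L2 a b)) :
    ℕ → Submodule ℝ (L2 a b)
  | 0 => X₀
  | p + 1 => (galerkinSpace (ContinuousLinearMap.adjoint K) Y₀ X₀ p).map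
      (K : L2 a b →ₗ[ℝ] L2 a b)

/-! ### Kolmogorov widths and optimal subspaces -/

/-- `E(A, 𝕏) = sup_{u ∈ A} ‖u - X u‖`, with `X` the `L²`-projector onto the finite-dimensional
subspace `𝕏`. -/
def deviation (A : Set (L2 a b)) (X : Submodule ℝ (L2 a b)) [FiniteDimensional ℝ X] : ℝ≥0∞ :=
  ⨆ u ∈ A, ENNReal.ofReal ‖u - X.starProjection u‖

/-- The Kolmogorov `n`-width `d_n(A)`, the infimum of `E(A, 𝕏)` over all `n`-dimensional
subspaces `𝕏` of `L²(a, b)`. -/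
def kolmogorovWidth (n : ℕ) (A : Set (L2 a b)) : ℝ≥0∞ :=
  ⨅ (X : Submodule ℝ (L2 a b)) (_ : FiniteDimensional ℝ X) (_ : Module.finrank ℝ X = n),
    deviation A X

/-- `𝕏` is optimal for the `n`-width of `A`. -/
def IsOptimal (n : ℕ) (A : Set (L2 a b)) (X : Submodule ℝ (L2 a b))
    [FiniteDimensional ℝ X] : Prop :=
  Module.finrank ℝ X ≤ n ∧ kolmogorovWidth n A = deviation A X

/-! ### Weak derivatives -/

/-- `v ∈ L²(a, b)` is the weak derivative of `u ∈ L²(a, b)`. -/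
def HasWeakDeriv (u v : L2 a b) : Prop :=
  ∀ φ : ℝ → ℝ, ContDiff ℝ ∞ φ → HasCompactSupport φ → tsupport φ ⊆ Set.Ioo a b →
    ∫ x in Set.Ioo a b, u x * deriv φ x = - ∫ x in Set.Ioo a b, v x * φ x

lemma integrable_mul_of_continuous (u : L2 a b) {φ : ℝ → ℝ} (h1 : Continuous φ)
    (h2 : HasCompactSupport φ) : Integrable (fun x => u x * φ x) (intervalMeasure a b) :=
  (Lp.memLp u).integrable_mul (q := 2)
    ((h1.memLp_of_hasCompactSupport (μ := volume) h2).restrict _)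

lemma integrable_mul_deriv (u : L2 a b) {φ : ℝ → ℝ} (h1 : ContDiff ℝ ∞ φ)
    (h2 : HasCompactSupport φ) : Integrable (fun x => u x * deriv φ x) (intervalMeasure a b) :=
  integrable_mul_of_continuous u (h1.continuous_deriv (by simp)) h2.deriv

lemma HasWeakDeriv.zero : HasWeakDeriv (0 : L2 a b) 0 := by
  intro φ _ _ _
  have h : ∀ g : ℝ → ℝ, ∫ x in Set.Ioo a b, (0 : L2 a b) x * g x = 0 := fun g => by
    rw [← integral_zero ℝ ℝ (μ := intervalMeasure a b)]
    apply integral_congr_ae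
    filter_upwards [Lp.coeFn_zero ℝ 2 (intervalMeasure a b)] with x hx
    rw [hx, Pi.zero_apply, zero_mul]
  rw [h, h, neg_zero]

lemma HasWeakDeriv.add {u u' v v' : L2 a b} (h : HasWeakDeriv u u') (g : HasWeakDeriv v v') :
    HasWeakDeriv (u + v) (u' + v') := by
  intro φ h1 h2 h3
  have e : ∀ (p q : L2 a b) {ψ : ℝ → ℝ}, Continuous ψ → HasCompactSupport ψ →
      ∫ x in Set.Ioo a b, (p + q) x * ψ x =
        (∫ x in Set.Ioo a b, p x * ψ x) + ∫ x in Set.Ioo a b, q x * ψ x := by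
    intro p q ψ c1 c2
    rw [← integral_add (integrable_mul_of_continuous p c1 c2)
      (integrable_mul_of_continuous q c1 c2)]
    apply integral_congr_ae
    filter_upwards [Lp.coeFn_add p q] with x hx
    rw [hx, Pi.add_apply, add_mul]
  rw [e u v (h1.continuous_deriv (by simp)) h2.deriv, e u' v' h1.continuous h2, h φ h1 h2 h3,
    g φ h1 h2 h3, neg_add]

lemma HasWeakDeriv.smul {u u' : L2 a b} (c : ℝ) (h : HasWeakDeriv u u') :
    HasWeakDeriv (c • u) (c • u') := by
  intro φ h1 h2 h3
  have e : ∀ (p : L2 a b) (ψ : ℝ → ℝ),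
      ∫ x in Set.Ioo a b, (c • p) x * ψ x = c * ∫ x in Set.Ioo a b, p x * ψ x := by
    intro p ψ
    rw [← integral_const_mul]
    apply integral_congr_ae
    filter_upwards [Lp.coeFn_smul c p] with x hx
    rw [hx, Pi.smul_apply, smul_eq_mul, mul_assoc]
  rw [e, e, h φ h1 h2 h3, mul_neg]

/-- Weak derivatives are unique. -/
lemma HasWeakDeriv.unique {u v w : L2 a b} (hv : HasWeakDeriv u v) (hw : HasWeakDeriv u w) :
    v = w := by
  have hint : ∀ q : L2 a b, IntegrableOn q (Set.Ioo a b) := fun q =>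
    (Lp.memLp q).integrable (by norm_num)
  have key : ∀ᵐ x, x ∈ Set.Ioo a b → v x - w x = 0 := by
    apply isOpen_Ioo.ae_eq_zero_of_integral_contDiff_smul_eq_zero
      ((hint v).sub (hint w)).locallyIntegrableOn
    intro φ h1 h2 h3
    have e := (hv φ h1 h2 h3).symm.trans (hw φ h1 h2 h3)
    have hs : ∫ x, φ x • (v x - w x) = ∫ x in Set.Ioo a b, (v x * φ x - w x * φ x) := by
      rw [← setIntegral_eq_integral_of_forall_compl_eq_zero (s := Set.Ioo a b)]
      · refine integral_congr_ae (Filter.Eventually.of_forall fun x => ?_)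
        simp only [smul_eq_mul]
        ring
      · intro x hx
        rw [image_eq_zero_of_notMem_tsupport fun h => hx (h3 h), zero_smul]
    refine hs.trans ?_
    rw [integral_sub (integrable_mul_of_continuous v h1.continuous h2)
      (integrable_mul_of_continuous w h1.continuous h2)]
    linarith
  apply Lp.ext
  filter_upwards [(ae_restrict_iff' measurableSet_Ioo).2 key] with x hx
  exact sub_eq_zero.1 hx

/-! ### Eigenvalues of the Galerkin problem -/

/-- For a space `V` of weakly differentiable functions: the space of all `ψ ∈ V` with
`(∂ψ, ∂v) = μ (ψ, v)` for all `v ∈ V`. -/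
def eigenspace (V : Submodule ℝ (L2 a b)) (μ : ℝ) : Submodule ℝ (L2 a b) where
  carrier := {ψ | ψ ∈ V ∧ ∃ dψ, HasWeakDeriv ψ dψ ∧
    ∀ v ∈ V, ∀ dv, HasWeakDeriv v dv → ⟪dψ, dv⟫_ℝ = μ * ⟪ψ, v⟫_ℝ}
  zero_mem' := ⟨V.zero_mem, 0, HasWeakDeriv.zero, by simp⟩
  add_mem' := by
    rintro ψ χ ⟨h1, dψ, h2, h3⟩ ⟨g1, dχ, g2, g3⟩
    refine ⟨V.add_mem h1 g1, dψ + dχ, h2.add g2, fun v hv dv hdv => ?_⟩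
    rw [inner_add_left, inner_add_left, h3 v hv dv hdv, g3 v hv dv hdv, mul_add]
  smul_mem' := by
    rintro c ψ ⟨h1, dψ, h2, h3⟩
    refine ⟨V.smul_mem c h1, c • dψ, h2.smul c, fun v hv dv hdv => ?_⟩
    rw [real_inner_smul_left, real_inner_smul_left, h3 v hv dv hdv]
    ring

/-- `μ` is the `l`-th eigenvalue (`l = 1, 2, …`) of the problem `(∂ψ, ∂v) = μ (ψ, v)` for all
`v ∈ V`, when the eigenvalues are listed increasingly and repeated according to multiplicity:
fewer than `l` eigenvalues are `< μ`, and at least `l` are `≤ μ`.  Eigenspaces of distinct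
eigenvalues being independent, the dimension of their sum counts multiplicities. -/
def IsNthEigenvalue (V : Submodule ℝ (L2 a b)) (l : ℕ) (μ : ℝ) : Prop :=
  Module.rank ℝ ↥(⨆ (ν : ℝ) (_ : ν < μ), eigenspace V ν) < (l : Cardinal) ∧
    (l : Cardinal) ≤ Module.rank ℝ ↥(⨆ (ν : ℝ) (_ : ν ≤ μ), eigenspace V ν)

end Abstract

end OutlierFree

end

open OutlierFree

/-! ### Reciprocal eigenvalues of compact positive operators -/

/-! By `hdK`, `∂` inverts `K` on `(ker K)ᗮ`. Hence the problem posed in `K(W)`, `W ≤ (ker K)ᗮ`,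
reads `(w, v) = μ (Kw, Kv)` on `W`: its eigenvalues are the reciprocals of those of `C* C`, `C =
K|_W` (`isNthEigenvalue_map_iff`). The exact problem has `W = (ker K)ᗮ`, the Galerkin problem `W =
𝕐_{p-1}`. As `K` is compact, the min-max principle holds for `‖w‖² / ‖Kw‖²`
(`IsNthRecipEigenvalue.le_of_forall_mem`), and restricting to a smaller `W` can only raise the
eigenvalues: this is the lower bound.

For the upper bound, the singular vectors `e` up to `μ_l` are projected orthogonally onto `𝕐_{p-1}`.
Projection does not increase `‖e‖ ≤ √μ_l ‖Ke‖`; if it changes `Ke` by at most `δ ‖Ke‖`, the quotient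
stays below `μ_l / (1 - δ)²` (`le_div_of_norm_map_sub_le`).

To find `δ`: spaces of `n` singular vectors approximate `K(B)` and `K*(B)` with error `σ =
1/√μ_{n+1}`, so the optimal `X₀`, `Y₀` do too. Since `K(I - Y)` is the adjoint of `(I - Y)K*` and `I
- Y` is idempotent, the error `σ` is inherited by all `𝕏_q`, `𝕐_q`, and `‖K(f - Yf)‖ ≤ σ ‖f - Yf‖`
for `Y = 𝕐_q`. Each application of `K` or `K*` thus gains a factor `σ`, and costs at most `√μ_l` on
singular vectors; `p + 1` of them give `δ = (μ_l/μ_{n+1})^((p+1)/2)`. -/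

section RecipEigenvalue

variable {W : Type*} [NormedAddCommGroup W] [InnerProductSpace ℝ W]

/-- The space of solutions of `w = ν T w`. -/
def recipEigenspace (T : W →L[ℝ] W) (ν : ℝ) : Submodule ℝ W :=
  LinearMap.ker (LinearMap.id - ν • (T : W →ₗ[ℝ] W))

/-- `μ` is the `l`-th reciprocal eigenvalue of `T`, counted with multiplicity. -/
def IsNthRecipEigenvalue (T : W →L[ℝ] W) (l : ℕ) (μ : ℝ) : Prop :=
  Module.rank ℝ ↥(⨆ (ν : ℝ) (_ : ν < μ), recipEigenspace T ν) < (l : Cardinal) ∧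
    (l : Cardinal) ≤ Module.rank ℝ ↥(⨆ (ν : ℝ) (_ : ν ≤ μ), recipEigenspace T ν)

variable {T : W →L[ℝ] W}

lemma mem_recipEigenspace {ν : ℝ} {w : W} : w ∈ recipEigenspace T ν ↔ w = ν • T w := by
  simp [recipEigenspace, sub_eq_zero]

lemma inner_map_self_nonneg (hT : T.IsPositive) (w : W) : 0 ≤ ⟪T w, w⟫_ℝ := by
  simpa using hT.inner_nonneg_left w

lemma recipEigenspace_of_nonpos (hT : T.IsPositive) {ν : ℝ} (hν : ν ≤ 0) :
    recipEigenspace T ν = ⊥ := by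
  rw [eq_bot_iff]
  intro w hw
  rw [mem_recipEigenspace] at hw
  have h1 : ⟪w, w⟫_ℝ = ν * ⟪T w, w⟫_ℝ := by
    conv_lhs => rw [hw, real_inner_smul_left]
    rw [← hw]
  have h2 := inner_map_self_nonneg hT w
  have h3 : ⟪w, w⟫_ℝ ≤ 0 := h1 ▸ mul_nonpos_of_nonpos_of_nonneg hν h2
  exact real_inner_self_nonpos.1 h3

lemma map_mem_iSup_recipEigenspace (s : ℝ → Prop) {w : W}
    (hw : w ∈ ⨆ (ν : ℝ) (_ : s ν), recipEigenspace T ν) :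
    T w ∈ ⨆ (ν : ℝ) (_ : s ν), recipEigenspace T ν := by
  have h : (⨆ (ν : ℝ) (_ : s ν), recipEigenspace T ν) ≤
      (⨆ (ν : ℝ) (_ : s ν), recipEigenspace T ν).comap (T : W →ₗ[ℝ] W) := by
    refine iSup₂_le fun ν hν v hv => ?_
    refine (le_iSup₂_of_le ν hν le_rfl : recipEigenspace T ν ≤ _) ?_
    rw [ContinuousLinearMap.coe_coe, mem_recipEigenspace, ← map_smul,
      ← mem_recipEigenspace.1 hv]
  exact h hw

/-- A solution of `v = ν T v` is the image of `ν • v`. This lets singular vectors be pulled back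
through `K*`. -/
lemma exists_map_eq_of_mem_iSup_recipEigenspace (s : ℝ → Prop) {w : W}
    (hw : w ∈ ⨆ (ν : ℝ) (_ : s ν), recipEigenspace T ν) :
    ∃ v ∈ ⨆ (ν : ℝ) (_ : s ν), recipEigenspace T ν, T v = w := by
  have h : (⨆ (ν : ℝ) (_ : s ν), recipEigenspace T ν) ≤
      (⨆ (ν : ℝ) (_ : s ν), recipEigenspace T ν).map (T : W →ₗ[ℝ] W) := by
    refine iSup₂_le fun ν hν v hv => ⟨ν • v, ?_, ?_⟩
    · exact Submodule.smul_mem _ _ ((le_iSup₂_of_le ν hν le_rfl : recipEigenspace T ν ≤ _) hv)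
    · rw [ContinuousLinearMap.coe_coe, map_smul, ← mem_recipEigenspace.1 hv]
  exact h hw

/-- On the orthogonal complement of the eigenspaces below `m`, the Rayleigh quotient is at
least `m`. -/
lemma mul_inner_le_of_mem_orthogonal [CompleteSpace W] (hT : T.IsPositive)
    (hc : IsCompactOperator T) (m : ℝ) {w : W}
    (hw : w ∈ (⨆ (ν : ℝ) (_ : ν < m), recipEigenspace T ν)ᗮ) :
    m * ⟪T w, w⟫_ℝ ≤ ‖w‖ ^ 2 := by
  rcases le_or_gt m 0 with hm | hm
  · exact (mul_nonpos_of_nonpos_of_nonneg hm (inner_map_self_nonneg hT w)).trans (sq_nonneg _)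
  set F := ⨆ (ν : ℝ) (_ : ν < m), recipEigenspace T ν with hF
  have hsym : ∀ x y, ⟪T x, y⟫_ℝ = ⟪x, T y⟫_ℝ := hT.isSymmetric
  have hinv : ∀ v ∈ Fᗮ, (T : W →ₗ[ℝ] W) v ∈ Fᗮ := by
    intro v hv u hu
    rw [ContinuousLinearMap.coe_coe, ← hsym]
    exact hv _ (map_mem_iSup_recipEigenspace _ hu)
  let S : Fᗮ →L[ℝ] Fᗮ := T.restrict hinv
  have hSc : IsCompactOperator S := hc.restrict' hinv
  have hS : IsSelfAdjoint S := by
    rw [ContinuousLinearMap.isSelfAdjoint_iff_isSymmetric]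
    exact fun x y => hsym x y
  -- Nonzero spectrum of the compact `S` consists of eigenvalues; one above `m⁻¹` would have its
  -- eigenvector in both `F` and `Fᗮ`. For self-adjoint `S` the spectral radius is the norm.
  have hrad : spectralRadius ℝ S ≤ ENNReal.ofReal m⁻¹ := by
    refine iSup₂_le fun r hr => ?_
    rcases eq_or_ne r 0 with rfl | h0
    · simp
    obtain ⟨v, hv⟩ := ((hSc.hasEigenvalue_iff_mem_spectrum h0).2 hr).exists_hasEigenvector
    have hv0 : (v : W) ≠ 0 := by simpa using hv.2
    have hTv : T v = r • (v : W) := congrArg Subtype.val hv.apply_eq_smul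
    have hrpos : 0 < r := by
      have h1 := inner_map_self_nonneg hT (v : W)
      rw [hTv, real_inner_smul_left, real_inner_self_eq_norm_sq] at h1
      have h2 : 0 < ‖(v : W)‖ ^ 2 := by positivity
      exact lt_of_le_of_ne (nonneg_of_mul_nonneg_left h1 h2) (Ne.symm h0)
    have hmr : m ≤ r⁻¹ := by
      by_contra! hlt
      have hmem : (v : W) ∈ F := by
        refine (le_iSup₂_of_le r⁻¹ hlt le_rfl : recipEigenspace T r⁻¹ ≤ _) ?_
        rw [mem_recipEigenspace, hTv, smul_smul, inv_mul_cancel₀ h0, one_smul]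
      exact hv0 (inner_self_eq_zero.1 (v.2 _ hmem))
    rw [← ENNReal.ofReal_coe_nnreal, coe_nnnorm, Real.norm_of_nonneg hrpos.le]
    exact ENNReal.ofReal_le_ofReal ((le_inv_comm₀ hm hrpos).1 hmr)
  rw [S.spectralRadius_eq_nnnorm hS, ← ENNReal.ofReal_coe_nnreal, coe_nnnorm,
    ENNReal.ofReal_le_ofReal_iff (by positivity)] at hrad
  have h1 : ⟪T w, w⟫_ℝ ≤ m⁻¹ * ‖w‖ ^ 2 := by
    calc ⟪T w, w⟫_ℝ = ⟪S ⟨w, hw⟩, ⟨w, hw⟩⟫_ℝ := rfl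
      _ ≤ ‖S ⟨w, hw⟩‖ * ‖w‖ := real_inner_le_norm _ _
      _ ≤ (m⁻¹ * ‖w‖) * ‖w‖ := by
        gcongr
        exact (S.le_opNorm _).trans (mul_le_mul_of_nonneg_right hrad (norm_nonneg _))
      _ = _ := by ring
  calc m * ⟪T w, w⟫_ℝ ≤ m * (m⁻¹ * ‖w‖ ^ 2) := by gcongr
    _ = _ := by field_simp

lemma inner_eq_zero_of_mem_recipEigenspace (hT : T.IsPositive) {ν ν' : ℝ} (h : ν ≠ ν') {u v : W}
    (hu : u ∈ recipEigenspace T ν) (hv : v ∈ recipEigenspace T ν') : ⟪u, v⟫_ℝ = 0 := by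
  rw [mem_recipEigenspace] at hu hv
  have hsym : ⟪T u, v⟫_ℝ = ⟪u, T v⟫_ℝ := hT.isSymmetric u v
  have h1 : ⟪u, v⟫_ℝ = ν * ⟪T u, v⟫_ℝ := by
    conv_lhs => rw [hu, real_inner_smul_left]
  have h2 : ⟪u, v⟫_ℝ = ν' * ⟪T u, v⟫_ℝ := by
    conv_lhs => rw [hv, real_inner_smul_right]
    rw [hsym]
  have h3 : (ν - ν') * ⟪T u, v⟫_ℝ = 0 := by linarith
  rcases mul_eq_zero.1 h3 with h4 | h4
  · exact absurd (sub_eq_zero.1 h4) h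
  · rw [h1, h4, mul_zero]

/-- On the sum of the eigenspaces up to `m`, the Rayleigh quotient is at most `m`. -/
lemma norm_sq_le_of_mem_iSup (hT : T.IsPositive) (m : ℝ) {w : W}
    (hw : w ∈ ⨆ (ν : ℝ) (_ : ν ≤ m), recipEigenspace T ν) :
    ‖w‖ ^ 2 ≤ m * ⟪T w, w⟫_ℝ := by
  obtain ⟨f, hf, rfl⟩ := (Submodule.mem_iSup_iff_exists_finsupp _ _).1 hw
  have hmem : ∀ ν, f ν ∈ recipEigenspace T ν ∧ (f ν = 0 ∨ ν ≤ m) := by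
    intro ν
    have := hf ν
    by_cases hν : ν ≤ m
    · simp only [hν, iSup_pos] at this
      exact ⟨this, Or.inr hν⟩
    · simp only [hν, iSup_false, Submodule.mem_bot] at this
      rw [this]
      exact ⟨Submodule.zero_mem _, Or.inl rfl⟩
  have hort : ∀ ν ν', ν ≠ ν' → ⟪f ν, f ν'⟫_ℝ = 0 := fun ν ν' h =>
    inner_eq_zero_of_mem_recipEigenspace hT h (hmem ν).1 (hmem ν').1
  have hort' : ∀ ν ν', ν ≠ ν' → ⟪T (f ν), f ν'⟫_ℝ = 0 := by
    intro ν ν' h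
    refine inner_eq_zero_of_mem_recipEigenspace hT h ?_ (hmem ν').1
    rw [mem_recipEigenspace, ← map_smul, ← mem_recipEigenspace.1 (hmem ν).1]
  rw [Finsupp.sum, ← real_inner_self_eq_norm_sq, map_sum, sum_inner, sum_inner,
    Finset.mul_sum]
  refine Finset.sum_le_sum fun ν hν => ?_
  rw [inner_sum, inner_sum, Finset.sum_eq_single_of_mem ν hν fun ν' _ h => hort ν ν' h.symm,
    Finset.sum_eq_single_of_mem ν hν fun ν' _ h => hort' ν ν' h.symm]
  rcases (hmem ν).2 with h0 | h
  · simp [h0]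
  · have h1 : ⟪f ν, f ν⟫_ℝ = ν * ⟪T (f ν), f ν⟫_ℝ := by
      conv_lhs => rw [mem_recipEigenspace.1 (hmem ν).1, real_inner_smul_left]
      rw [← mem_recipEigenspace.1 (hmem ν).1]
    rw [h1]
    exact mul_le_mul_of_nonneg_right h (inner_map_self_nonneg hT _)

/-- The min-max bound for the `l`-th reciprocal eigenvalue. -/
lemma IsNthRecipEigenvalue.le_of_forall_mem [CompleteSpace W] (hT : T.IsPositive)
    (hc : IsCompactOperator T) {l : ℕ} {μ M : ℝ} (hμ : IsNthRecipEigenvalue T l μ)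
    {G : Submodule ℝ W} (hG : (l : Cardinal) ≤ Module.rank ℝ G)
    (hGM : ∀ g ∈ G, ‖g‖ ^ 2 ≤ M * ⟪T g, g⟫_ℝ) : μ ≤ M := by
  set F := ⨆ (ν : ℝ) (_ : ν < μ), recipEigenspace T ν with hF
  have hfin : FiniteDimensional ℝ F :=
    Module.rank_lt_aleph0_iff.1 (hμ.1.trans (Cardinal.natCast_lt_aleph0))
  have hlt : Module.rank ℝ F < Module.rank ℝ G := hμ.1.trans_le hG
  -- `F` has smaller dimension than `G`, so some nonzero `g ∈ G` is orthogonal to `F`.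
  let φ : G →ₗ[ℝ] F := (F.orthogonalProjectionOnto : W →ₗ[ℝ] F) ∘ₗ G.subtype
  have hker : LinearMap.ker φ ≠ ⊥ := fun h =>
    hlt.not_ge (LinearMap.rank_le_of_injective φ (LinearMap.ker_eq_bot.1 h))
  obtain ⟨g, hg, hg0⟩ := Submodule.exists_mem_ne_zero_of_ne_bot hker
  have hgF : (g : W) ∈ Fᗮ := by
    rw [← F.ker_orthogonalProjectionOnto]
    exact hg
  have h1 := mul_inner_le_of_mem_orthogonal hT hc μ hgF
  have h2 := hGM g g.2
  have h3 : 0 < ‖(g : W)‖ ^ 2 := by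
    have : (g : W) ≠ 0 := by simpa using hg0
    positivity
  have h4 : 0 < ⟪T (g : W), g⟫_ℝ := by
    refine lt_of_le_of_ne (inner_map_self_nonneg hT _) fun h => ?_
    rw [← h, mul_zero] at h2
    linarith
  exact le_of_mul_le_mul_right (h1.trans h2) h4

lemma IsNthRecipEigenvalue.pos (hT : T.IsPositive) {l : ℕ} {μ : ℝ} (hl : 1 ≤ l)
    (hμ : IsNthRecipEigenvalue T l μ) : 0 < μ := by
  by_contra! h
  have h0 : (⨆ (ν : ℝ) (_ : ν ≤ μ), recipEigenspace T ν) = ⊥ := by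
    rw [eq_bot_iff]
    exact iSup₂_le fun ν hν => (recipEigenspace_of_nonpos hT (hν.trans h)).le
  have h1 := hμ.2
  rw [h0, rank_bot] at h1
  have : l = 0 := by simpa using h1
  omega

lemma IsNthRecipEigenvalue.mono {l l' : ℕ} {μ μ' : ℝ} (h : l ≤ l')
    (hμ : IsNthRecipEigenvalue T l μ) (hμ' : IsNthRecipEigenvalue T l' μ') : μ ≤ μ' := by
  by_contra! hlt
  have h1 : (⨆ (ν : ℝ) (_ : ν ≤ μ'), recipEigenspace T ν) ≤
      ⨆ (ν : ℝ) (_ : ν < μ), recipEigenspace T ν :=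
    iSup₂_le fun ν hν => le_iSup₂_of_le ν (hν.trans_lt hlt) le_rfl
  have h2 := (hμ'.2.trans (Submodule.rank_mono h1)).trans_lt hμ.1
  exact absurd (Nat.cast_lt.1 h2) (by omega)

/-- The gap places everything counted up to `μ` strictly below `μ'`, which forces equality. -/
lemma rank_iSup_recipEigenspace_of_lt {l : ℕ} {μ μ' : ℝ} (h : μ < μ')
    (hμ : IsNthRecipEigenvalue T l μ) (hμ' : IsNthRecipEigenvalue T (l + 1) μ') :
    Module.rank ℝ ↥(⨆ (ν : ℝ) (_ : ν < μ'), recipEigenspace T ν) = l := by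
  apply le_antisymm
  · exact Order.lt_succ_iff.1 (by simpa using! hμ'.1)
  · refine hμ.2.trans (Submodule.rank_mono ?_)
    exact iSup₂_le fun ν hν => le_iSup₂_of_le ν (hν.trans_lt h) le_rfl

lemma iSup_recipEigenspace_eq_top [FiniteDimensional ℝ W] (hT : T.IsPositive)
    (hinj : Function.Injective T) : ⨆ ν : ℝ, recipEigenspace T ν = ⊤ := by
  have hsym : (T : W →ₗ[ℝ] W).IsSymmetric := hT.isSymmetric
  have h := Submodule.orthogonal_eq_bot_iff.1 hsym.orthogonalComplement_iSup_eigenspaces_eq_bot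
  rw [eq_top_iff, ← h]
  refine iSup_le fun r v hv => ?_
  rw [Module.End.mem_eigenspace_iff, ContinuousLinearMap.coe_coe] at hv
  refine (le_iSup _ r⁻¹ : recipEigenspace T r⁻¹ ≤ _) ?_
  rw [mem_recipEigenspace, hv, smul_smul]
  -- For `r = 0` the index `r⁻¹` is `0` by convention; injectivity leaves only the zero vector
  -- there.
  rcases eq_or_ne r 0 with rfl | h0
  · rw [zero_smul] at hv
    simp [hinj (hv.trans (map_zero T).symm)]
  · rw [inv_mul_cancel₀ h0, one_smul]

lemma finite_setOf_recipEigenspace_ne_bot [FiniteDimensional ℝ W] :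
    {ν : ℝ | recipEigenspace T ν ≠ ⊥}.Finite := by
  have h := Module.End.finite_hasEigenvalue (T : Module.End ℝ W)
  refine (h.image (·⁻¹)).subset fun ν hν => ⟨ν⁻¹, ?_, inv_inv ν⟩
  obtain ⟨v, hv, hv0⟩ := Submodule.exists_mem_ne_zero_of_ne_bot hν
  rw [mem_recipEigenspace] at hv
  have h0 : ν ≠ 0 := by
    rintro rfl
    exact hv0 (by rw [hv, zero_smul])
  refine Module.End.hasEigenvalue_of_hasEigenvector (x := v) ⟨?_, hv0⟩
  rw [Module.End.mem_eigenspace_iff, ContinuousLinearMap.coe_coe]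
  conv_rhs => rw [hv]
  rw [smul_smul, inv_mul_cancel₀ h0, one_smul]

lemma exists_isNthRecipEigenvalue [FiniteDimensional ℝ W] (hT : T.IsPositive)
    (hinj : Function.Injective T) {l : ℕ} (hl : 1 ≤ l) (hlW : l ≤ Module.finrank ℝ W) :
    ∃ μ, IsNthRecipEigenvalue T l μ := by
  set E := {ν : ℝ | recipEigenspace T ν ≠ ⊥} with hE
  have hEfin : E.Finite := finite_setOf_recipEigenspace_ne_bot
  -- `μ` is the largest of the finitely many eigenvalues satisfying `s`. Used with `s` always true,
  -- then with `ν < μ` to contradict minimality.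
  have key : ∀ s : ℝ → Prop,
      (l : Cardinal) ≤ Module.rank ℝ ↥(⨆ (ν : ℝ) (_ : s ν), recipEigenspace T ν) →
      ∃ μ ∈ E, s μ ∧
        (l : Cardinal) ≤ Module.rank ℝ ↥(⨆ (ν : ℝ) (_ : ν ≤ μ), recipEigenspace T ν) := by
    intro s hs
    have hne : {ν ∈ E | s ν}.Nonempty := by
      by_contra! hemp
      have h0 : (⨆ (ν : ℝ) (_ : s ν), recipEigenspace T ν) = ⊥ := by
        rw [eq_bot_iff]
        refine iSup₂_le fun ν hν => ?_
        by_contra hb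
        exact (Set.eq_empty_iff_forall_notMem.1 hemp ν) ⟨fun h => hb h.le, hν⟩
      rw [h0, rank_bot] at hs
      have : l = 0 := by simpa using hs
      omega
    obtain ⟨μ, hμ, hmax⟩ :=
      Set.exists_max_image _ id (hEfin.subset (Set.sep_subset E s)) hne
    refine ⟨μ, hμ.1, hμ.2, hs.trans (Submodule.rank_mono (iSup₂_le fun ν hν => ?_))⟩
    by_cases hb : recipEigenspace T ν = ⊥
    · rw [hb]
      exact bot_le
    · exact le_iSup₂_of_le ν (hmax ν ⟨hb, hν⟩) le_rfl
  set A := {μ ∈ E |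
    (l : Cardinal) ≤ Module.rank ℝ ↥(⨆ (ν : ℝ) (_ : ν ≤ μ), recipEigenspace T ν)} with hA
  have hAne : A.Nonempty := by
    obtain ⟨μ, h1, -, h2⟩ := key (fun _ => True) (by
      have htop : (⨆ (ν : ℝ) (_ : True), recipEigenspace T ν) = ⊤ := by
        rw [← iSup_recipEigenspace_eq_top hT hinj]
        exact iSup_congr fun ν => iSup_pos trivial
      rw [htop, rank_top, ← Module.finrank_eq_rank]
      exact_mod_cast hlW)
    exact ⟨μ, h1, h2⟩
  obtain ⟨μ, hμ, hmin⟩ := Set.exists_min_image A id (hEfin.subset (Set.sep_subset _ _)) hAne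
  refine ⟨μ, ?_, hμ.2⟩
  by_contra! h
  obtain ⟨μ', h1, h2, h3⟩ := key (fun ν => ν < μ) h
  exact (hmin μ' ⟨h1, h3⟩).not_gt h2

end RecipEigenvalue

/-! ### Compactness of integral operators -/

section Compact

open Filter Topology

/-- Every bounded sequence in a separable Hilbert space has a weakly convergent subsequence. -/
lemma exists_subseq_tendsto_inner {H : Type*} [NormedAddCommGroup H] [InnerProductSpace ℝ H]
    [CompleteSpace H] [TopologicalSpace.SeparableSpace H] {r : ℝ} (f : ℕ → H)
    (hf : ∀ j, ‖f j‖ ≤ r) :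
    ∃ g : H, ‖g‖ ≤ r ∧ ∃ φ : ℕ → ℕ, StrictMono φ ∧
      ∀ h, Tendsto (fun j => ⟪f (φ j), h⟫_ℝ) atTop (𝓝 ⟪g, h⟫_ℝ) := by
  -- Sequential Banach–Alaoglu in the dual, carried back by the Riesz isomorphism.
  obtain ⟨ξ, hξ, φ, hφ, hlim⟩ := WeakDual.isSeqCompact_closedBall ℝ H 0 r
    (x := fun j => StrongDual.toWeakDual (InnerProductSpace.toDual ℝ H (f j)))
    (fun j => by simpa using hf j)
  refine ⟨(InnerProductSpace.toDual ℝ H).symm (WeakDual.toStrongDual ξ), by simpa using hξ, φ, hφ,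
    fun h => ?_⟩
  have h1 := (WeakDual.eval_continuous (𝕜 := ℝ) h).tendsto ξ |>.comp hlim
  rw [InnerProductSpace.toDual_symm_apply]
  exact h1

namespace OutlierFree

variable {a b : ℝ} {k : ℝ → ℝ → ℝ}

lemma integralOperator_coeFn (hk : IsL2Kernel a b k) (f : L2 a b) :
    integralOperator k hk f =ᵐ[intervalMeasure a b]
      fun x => ∫ y, k x y * f y ∂(intervalMeasure a b) :=
  (hk.memLp_integral f).coeFn_toLp

lemma norm_integralOperator_sq (hk : IsL2Kernel a b k) (f : L2 a b) :
    ‖integralOperator k hk f‖ ^ 2 =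
      ∫ x, (∫ y, k x y * f y ∂(intervalMeasure a b)) ^ 2 ∂(intervalMeasure a b) := by
  rw [← real_inner_self_eq_norm_sq, L2.inner_def]
  apply integral_congr_ae
  filter_upwards [integralOperator_coeFn hk f] with x hx
  simp [hx, sq]

lemma tendsto_integral_mul_of_tendsto_inner {g : ℝ → ℝ} (hg : MemLp g 2 (intervalMeasure a b))
    {f : ℕ → L2 a b} {f₀ : L2 a b}
    (hlim : ∀ h, Tendsto (fun j => ⟪f j, h⟫_ℝ) atTop (𝓝 ⟪f₀, h⟫_ℝ)) :
    Tendsto (fun j => ∫ y, g y * (f j - f₀) y ∂(intervalMeasure a b)) atTop (𝓝 0) := by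
  have h1 : ∀ f : L2 a b, ∫ y, g y * f y ∂(intervalMeasure a b) = ⟪f, hg.toLp g⟫_ℝ := by
    intro f
    rw [L2.inner_def]
    apply integral_congr_ae
    filter_upwards [hg.coeFn_toLp] with y hy
    simp [hy]
  simp_rw [h1, inner_sub_left]
  simpa using (hlim (hg.toLp g)).sub_const ⟪f₀, hg.toLp g⟫_ℝ

/-- An integral operator maps weakly convergent bounded sequences to convergent sequences. -/
lemma tendsto_integralOperator (hk : IsL2Kernel a b k) {r : ℝ} {f : ℕ → L2 a b} {f₀ : L2 a b}
    (hf : ∀ j, ‖f j‖ ≤ r) (hf₀ : ‖f₀‖ ≤ r)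
    (hlim : ∀ h, Tendsto (fun j => ⟪f j, h⟫_ℝ) atTop (𝓝 ⟪f₀, h⟫_ℝ)) :
    Tendsto (fun j => integralOperator k hk (f j)) atTop (𝓝 (integralOperator k hk f₀)) := by
  rw [tendsto_iff_norm_sub_tendsto_zero]
  simp_rw [← map_sub]
  have hsq : Tendsto (fun j => ‖integralOperator k hk (f j - f₀)‖ ^ 2) atTop (𝓝 0) := by
    simp_rw [norm_integralOperator_sq]
    rw [← integral_zero ℝ ℝ (μ := intervalMeasure a b)]
    -- For almost every `x` the inner integral pairs a weakly null sequence with `k x ∈ L²`;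
    -- Cauchy–Schwarz supplies the majorant.
    refine tendsto_integral_of_dominated_convergence
      (fun x => (∫ y, k x y ^ 2 ∂(intervalMeasure a b)) * (r + r) ^ 2)
      (fun j => (hk.aestronglyMeasurable _).pow 2)
      (hk.integrable_sq.integral_prod_left.mul_const _) (fun j => ?_) ?_
    · filter_upwards [hk.sq_le (f j - f₀)] with x hx
      rw [Real.norm_of_nonneg (sq_nonneg _)]
      refine hx.trans ?_
      have h1 : ‖f j - f₀‖ ≤ r + r := (norm_sub_le _ _).trans (add_le_add (hf j) hf₀)
      have h2 : 0 ≤ ∫ y, k x y ^ 2 ∂(intervalMeasure a b) := integral_nonneg fun y => sq_nonneg _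
      gcongr
    · filter_upwards [hk.ae_memLp] with x hx
      simpa using (tendsto_integral_mul_of_tendsto_inner hx hlim).pow 2
  simpa [Real.sqrt_sq] using hsq.sqrt

/-- The unit ball is weakly sequentially compact and the operator turns weak into norm convergence,
so the image of the ball is itself compact. -/
lemma isCompactOperator_integralOperator (hk : IsL2Kernel a b k) :
    IsCompactOperator (integralOperator k hk) := by
  -- Finiteness of the exponent provides separability of `L²`.
  have : Fact ((2 : ℝ≥0∞) ≠ ⊤) := ⟨by simp⟩
  refine (isCompactOperator_iff_image_closedBall_subset_compact
    (integralOperator k hk : L2 a b →ₗ[ℝ] L2 a b) one_pos).2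
    ⟨_, IsSeqCompact.isCompact (fun u hu => ?_), subset_rfl⟩
  choose f hf hfu using hu
  obtain ⟨g, hg, φ, hφ, hlim⟩ := exists_subseq_tendsto_inner (r := 1) f
    (fun j => by simpa using hf j)
  refine ⟨_, ⟨g, by simpa using hg, rfl⟩, φ, hφ, ?_⟩
  have := tendsto_integralOperator hk (fun j => by simpa using hf (φ j)) hg hlim
  refine this.congr fun j => ?_
  exact hfu (φ j)

end OutlierFree

end Compact

/-! ### Approximation of the range of an operator -/

section Approximation

variable {H : Type*} [NormedAddCommGroup H] [InnerProductSpace ℝ H]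

/-- The subspace `X` approximates the image of the unit ball under `K` up to the error `σ`. -/
def ApproximatesRange (K : H →L[ℝ] H) (X : Submodule ℝ H) [FiniteDimensional ℝ X] (σ : ℝ) : Prop :=
  ∀ f, ‖K f - X.starProjection (K f)‖ ≤ σ * ‖f‖

lemma norm_sub_starProjection_le (X : Submodule ℝ H) [FiniteDimensional ℝ X] (u : H) {v : H}
    (hv : v ∈ X) : ‖u - X.starProjection u‖ ≤ ‖u - v‖ := by
  rw [X.starProjection_minimal]
  exact ciInf_le ⟨0, by rintro _ ⟨x, rfl⟩; exact norm_nonneg _⟩ (⟨v, hv⟩ : X)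

/-- `K(Yf)` is a competitor in `K(Y)` for the best approximation of `Kf`. -/
lemma norm_map_sub_starProjection_le (K : H →L[ℝ] H) (Y : Submodule ℝ H) [FiniteDimensional ℝ Y]
    (f : H) :
    ‖K f - (Y.map (K : H →ₗ[ℝ] H)).starProjection (K f)‖ ≤ ‖K (f - Y.starProjection f)‖ := by
  rw [map_sub]
  exact norm_sub_starProjection_le _ _ ⟨_, Y.starProjection_apply_mem f, rfl⟩

lemma inner_sub_starProjection (X : Submodule ℝ H) [FiniteDimensional ℝ X] (g v : H) :
    ⟪g - X.starProjection g, v⟫_ℝ =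
      ⟪g - X.starProjection g, v - X.starProjection v⟫_ℝ := by
  rw [inner_sub_right, X.starProjection_inner_eq_zero g _ (X.starProjection_apply_mem v), sub_zero]

variable [CompleteSpace H]

/-- `K*(I - X)` is the adjoint of `(I - X)K`. By idempotence the right side keeps `‖g - Xg‖` instead
of `‖g‖`, which is what lets the factors `σ` accumulate. -/
lemma ApproximatesRange.norm_adjoint_le {K : H →L[ℝ] H} {X : Submodule ℝ H}
    [FiniteDimensional ℝ X] {σ : ℝ} (h : ApproximatesRange K X σ) (g : H) :
    ‖ContinuousLinearMap.adjoint K (g - X.starProjection g)‖ ≤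
      σ * ‖g - X.starProjection g‖ := by
  set e := g - X.starProjection g with he
  set d := ContinuousLinearMap.adjoint K e with hd
  have h1 : ‖d‖ * ‖d‖ ≤ (σ * ‖e‖) * ‖d‖ := by
    calc ‖d‖ * ‖d‖ = ⟪e, K d⟫_ℝ := by
          rw [← real_inner_self_eq_norm_mul_norm, hd, ContinuousLinearMap.adjoint_inner_left]
      _ = ⟪e, K d - X.starProjection (K d)⟫_ℝ := inner_sub_starProjection X g _
      _ ≤ ‖e‖ * ‖K d - X.starProjection (K d)‖ := real_inner_le_norm _ _
      _ ≤ ‖e‖ * (σ * ‖d‖) := by gcongr; exact h d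
      _ = _ := by ring
  rcases (norm_nonneg d).eq_or_lt with h0 | h0
  -- No sign of `σ` is assumed; `h e` itself shows `0 ≤ σ * ‖e‖`.
  · rw [← h0]
    by_contra! hlt
    have h2 := (norm_nonneg _).trans (h e)
    exact hlt.not_ge h2
  · exact le_of_mul_le_mul_right h1 h0

/-- The converse duality: `(I - F)K*` is the adjoint of `K(I - F)`. -/
lemma ApproximatesRange.of_norm_map_le {K : H →L[ℝ] H} {F : Submodule ℝ H}
    [FiniteDimensional ℝ F] {σ : ℝ} (h : ∀ g, ‖K (g - F.starProjection g)‖ ≤ σ * ‖g‖) :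
    ApproximatesRange (ContinuousLinearMap.adjoint K) F σ := by
  intro f
  set e := ContinuousLinearMap.adjoint K f - F.starProjection (ContinuousLinearMap.adjoint K f)
    with he
  have h0 : F.starProjection e = 0 := by
    rw [he, map_sub, F.starProjection_eq_self_iff.2 (F.starProjection_apply_mem _), sub_self]
  have h2 := h e
  rw [h0, sub_zero] at h2
  have h1 : ‖e‖ * ‖e‖ ≤ (σ * ‖f‖) * ‖e‖ := by
    calc ‖e‖ * ‖e‖ = ⟪e, ContinuousLinearMap.adjoint K f⟫_ℝ := by
          rw [← real_inner_self_eq_norm_mul_norm, he, ← inner_sub_starProjection]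
      _ = ⟪K e, f⟫_ℝ := ContinuousLinearMap.adjoint_inner_right _ _ _
      _ ≤ ‖K e‖ * ‖f‖ := real_inner_le_norm _ _
      _ ≤ (σ * ‖e‖) * ‖f‖ := by gcongr
      _ = _ := by ring
  rcases (norm_nonneg e).eq_or_lt with h3 | h3
  · rw [← h3]
    exact (norm_nonneg _).trans (h f)
  · exact le_of_mul_le_mul_right h1 h3

lemma ApproximatesRange.map {K : H →L[ℝ] H} {Y : Submodule ℝ H} [FiniteDimensional ℝ Y] {σ : ℝ}
    (hσ : 0 ≤ σ) (h : ApproximatesRange (ContinuousLinearMap.adjoint K) Y σ) :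
    ApproximatesRange K (Y.map (K : H →ₗ[ℝ] H)) σ := by
  intro f
  refine (norm_map_sub_starProjection_le K Y f).trans ?_
  have h1 := h.norm_adjoint_le f
  rw [ContinuousLinearMap.adjoint_adjoint] at h1
  refine h1.trans (mul_le_mul_of_nonneg_left ?_ hσ)
  simpa using norm_sub_starProjection_le Y f Y.zero_mem

end Approximation

/-! ### Approximation by the alternating spaces `𝕏_p`, `𝕐_p` -/

namespace OutlierFree

variable {a b : ℝ}

instance finiteDimensional_galerkinSpace (K : L2 a b →L[ℝ] L2 a b) (X₀ Y₀ : Submodule ℝ (L2 a b))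
    [FiniteDimensional ℝ X₀] [FiniteDimensional ℝ Y₀] (p : ℕ) :
    FiniteDimensional ℝ (galerkinSpace K X₀ Y₀ p) := by
  induction p generalizing K X₀ Y₀ with
  | zero => assumption
  | succ p ih =>
    have := ih (ContinuousLinearMap.adjoint K) Y₀ X₀
    exact inferInstanceAs (FiniteDimensional ℝ
      ((galerkinSpace (ContinuousLinearMap.adjoint K) Y₀ X₀ p).map (K : L2 a b →ₗ[ℝ] L2 a b)))

lemma galerkinSpace_le_orthogonal_ker (K : L2 a b →L[ℝ] L2 a b) {X₀ : Submodule ℝ (L2 a b)}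
    (Y₀ : Submodule ℝ (L2 a b)) (hX₀ : X₀ ⟂ (ContinuousLinearMap.adjoint K).ker) (p : ℕ) :
    galerkinSpace K X₀ Y₀ p ≤ ((ContinuousLinearMap.adjoint K).ker)ᗮ := by
  cases p with
  | zero => exact hX₀
  | succ p =>
    rintro _ ⟨y, -, rfl⟩ v hv
    have h0 : ContinuousLinearMap.adjoint K v = 0 := hv
    rw [ContinuousLinearMap.coe_coe, ← ContinuousLinearMap.adjoint_inner_left, h0, inner_zero_left]

lemma approximatesRange_galerkinSpace {σ : ℝ} (hσ : 0 ≤ σ) (K : L2 a b →L[ℝ] L2 a b)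
    (X₀ Y₀ : Submodule ℝ (L2 a b)) [FiniteDimensional ℝ X₀] [FiniteDimensional ℝ Y₀]
    (hX : ApproximatesRange K X₀ σ) (hY : ApproximatesRange (ContinuousLinearMap.adjoint K) Y₀ σ)
    (p : ℕ) : ApproximatesRange K (galerkinSpace K X₀ Y₀ p) σ := by
  induction p generalizing K X₀ Y₀ with
  | zero => exact hX
  | succ p ih =>
    exact (ih (ContinuousLinearMap.adjoint K) Y₀ X₀ hY
      (by rwa [ContinuousLinearMap.adjoint_adjoint])).map hσ

/-- The approximation order of the spaces `galerkinSpace` on spaces of singular vectors. -/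
lemma norm_sub_starProjection_galerkinSpace_le {σ c : ℝ} (hσ : 0 ≤ σ) (hc : 0 < c)
    (K : L2 a b →L[ℝ] L2 a b) (X₀ Y₀ S S' : Submodule ℝ (L2 a b)) [FiniteDimensional ℝ X₀]
    [FiniteDimensional ℝ Y₀] (hX : ApproximatesRange K X₀ σ)
    (hY : ApproximatesRange (ContinuousLinearMap.adjoint K) Y₀ σ)
    (hS : ∀ u ∈ S, ∃ f ∈ S', K f = u)
    (hS' : ∀ f ∈ S', ∃ u ∈ S, ContinuousLinearMap.adjoint K u = f)
    (hcS' : ∀ f ∈ S', c * ‖f‖ ≤ ‖K f‖)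
    (hcS : ∀ u ∈ S, c * ‖u‖ ≤ ‖ContinuousLinearMap.adjoint K u‖) (q : ℕ) {u : L2 a b}
    (hu : u ∈ S) :
    ‖u - (galerkinSpace K X₀ Y₀ q).starProjection u‖ ≤ (σ / c) ^ (q + 1) * ‖u‖ := by
  have hf : ∀ f u : L2 a b, c * ‖f‖ ≤ ‖u‖ → σ * ‖f‖ ≤ σ / c * ‖u‖ := by
    intro f u h
    calc σ * ‖f‖ = σ / c * (c * ‖f‖) := by field_simp
      _ ≤ _ := by gcongr
  induction q generalizing K X₀ Y₀ S S' u with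
  | zero =>
    obtain ⟨f, hfS, rfl⟩ := hS u hu
    rw [zero_add, pow_one]
    exact (hX f).trans (hf _ _ (hcS' f hfS))
  | succ q ih =>
    obtain ⟨f, hfS, rfl⟩ := hS u hu
    have hX' : ApproximatesRange (ContinuousLinearMap.adjoint (ContinuousLinearMap.adjoint K))
        X₀ σ := by rwa [ContinuousLinearMap.adjoint_adjoint]
    -- With `u = Kf`, the error of `f` in `𝕐_q` is the same statement for `K*`, the two families
    -- swapped.
    have h1 := ih (ContinuousLinearMap.adjoint K) Y₀ X₀ S' S hY hX' hS'
      (by rwa [ContinuousLinearMap.adjoint_adjoint]) hcS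
      (by rwa [ContinuousLinearMap.adjoint_adjoint]) hfS
    have h2 := (approximatesRange_galerkinSpace hσ (ContinuousLinearMap.adjoint K) Y₀ X₀ hY hX'
      q).norm_adjoint_le f
    rw [ContinuousLinearMap.adjoint_adjoint] at h2
    calc _ ≤ _ := norm_map_sub_starProjection_le K _ f
      _ ≤ _ := h2
      _ ≤ σ * ((σ / c) ^ (q + 1) * ‖f‖) := by gcongr
      _ = (σ / c) ^ (q + 1) * (σ * ‖f‖) := by ring
      _ ≤ (σ / c) ^ (q + 1) * (σ / c * ‖K f‖) := by
        gcongr ?_ * ?_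
        exact hf _ _ (hcS' f hfS)
      _ = _ := by ring

/-! ### Widths -/

lemma deviation_le_ofReal_iff {K : L2 a b →L[ℝ] L2 a b} {X : Submodule ℝ (L2 a b)}
    [FiniteDimensional ℝ X] {σ : ℝ} (hσ : 0 ≤ σ) :
    deviation (functionClass K 1) X ≤ ENNReal.ofReal σ ↔ ApproximatesRange K X σ := by
  have h0 : deviation (functionClass K 1) X ≤ ENNReal.ofReal σ ↔
      ∀ f : L2 a b, ‖f‖ ≤ 1 → ‖K f - X.starProjection (K f)‖ ≤ σ := by
    simp only [deviation, functionClass, iSup_le_iff, Set.forall_mem_image,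
      ENNReal.ofReal_le_ofReal_iff hσ, mem_closedBall_zero_iff]
  rw [h0]
  constructor
  · intro h f
    rcases eq_or_ne f 0 with rfl | hf
    · simp
    have hf' : 0 < ‖f‖ := norm_pos_iff.2 hf
    have h1 := h (‖f‖⁻¹ • f) (by rw [norm_smul, norm_inv, norm_norm, inv_mul_cancel₀ hf'.ne'])
    rw [map_smul, map_smul, ← smul_sub, norm_smul, norm_inv, norm_norm,
      inv_mul_le_iff₀ hf', mul_comm] at h1
    exact h1
  · intro h f hf
    exact (h f).trans (mul_le_of_le_one_right hσ hf)

/-- An optimal space does at least as well as any `n`-dimensional competitor, so the width need not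
be computed. -/
lemma IsOptimal.approximatesRange {K : L2 a b →L[ℝ] L2 a b} {X Y : Submodule ℝ (L2 a b)}
    [FiniteDimensional ℝ X] [FiniteDimensional ℝ Y] {n : ℕ} {σ : ℝ} (hσ : 0 ≤ σ)
    (hX : IsOptimal n (functionClass K 1) X) (hn : Module.finrank ℝ Y = n)
    (hY : ApproximatesRange K Y σ) : ApproximatesRange K X σ := by
  rw [← deviation_le_ofReal_iff hσ] at hY ⊢
  rw [← hX.2]
  exact (iInf₂_le_of_le Y ‹_› (iInf_le _ hn)).trans hY

/-! ### The Galerkin problem in terms of singular values -/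

lemma injective_comp_subtype {K : L2 a b →L[ℝ] L2 a b} {W : Submodule ℝ (L2 a b)} (hW : W ≤ K.kerᗮ) :
    Function.Injective ((K : L2 a b →ₗ[ℝ] L2 a b) ∘ₗ W.subtype) := by
  rw [injective_iff_map_eq_zero]
  intro w hw
  have h1 : (w : L2 a b) ∈ K.ker := hw
  exact Subtype.ext (inner_self_eq_zero.1 (hW w.2 _ h1))

/-- The operator `C* C`, where `C` is the restriction of `K` to `W`. -/
noncomputable def gramOperator (K : L2 a b →L[ℝ] L2 a b) (W : Submodule ℝ (L2 a b)) [CompleteSpace W] :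
    W →L[ℝ] W :=
  ContinuousLinearMap.adjoint (K ∘L W.subtypeL) ∘L (K ∘L W.subtypeL)

section Gram

variable {K : L2 a b →L[ℝ] L2 a b} {W : Submodule ℝ (L2 a b)} [CompleteSpace W]

lemma inner_gramOperator (w v : W) :
    ⟪gramOperator K W w, v⟫_ℝ = ⟪K w, K v⟫_ℝ := by
  simp [gramOperator, ContinuousLinearMap.adjoint_inner_left]

lemma isPositive_gramOperator : (gramOperator K W).IsPositive :=
  ContinuousLinearMap.isPositive_adjoint_comp_self _

lemma isCompactOperator_gramOperator (hK : IsCompactOperator K) :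
    IsCompactOperator (gramOperator K W) :=
  (hK.comp_clm W.subtypeL).clm_comp (ContinuousLinearMap.adjoint (K ∘L W.subtypeL))

lemma injective_gramOperator (hW : W ≤ K.kerᗮ) : Function.Injective (gramOperator K W) := by
  rw [injective_iff_map_eq_zero]
  intro w hw
  have h1 := inner_gramOperator (K := K) w w
  rw [hw, inner_zero_left] at h1
  exact (injective_iff_map_eq_zero _).1 (injective_comp_subtype hW) w
    (inner_self_eq_zero.1 h1.symm)

lemma mem_recipEigenspace_gramOperator {ν : ℝ} {w : W} :
    w ∈ recipEigenspace (gramOperator K W) ν ↔ ∀ v : W, ⟪w, v⟫_ℝ = ν * ⟪K w, K v⟫_ℝ := by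
  simp_rw [← inner_gramOperator, ← real_inner_smul_left]
  rw [mem_recipEigenspace]
  exact ⟨fun h v => congrArg (⟪·, v⟫_ℝ) h, ext_inner_right ℝ⟩

/-- Weak derivatives are unique, so `∂Kw = w` replaces every derivative in the weak form by its
preimage in `W`. -/
lemma eigenspace_map (hd : ∀ f ∈ K.kerᗮ, HasWeakDeriv (K f) f) (hW : W ≤ K.kerᗮ) (ν : ℝ) :
    eigenspace (W.map (K : L2 a b →ₗ[ℝ] L2 a b)) ν =
      (recipEigenspace (gramOperator K W) ν).map ((K : L2 a b →ₗ[ℝ] L2 a b) ∘ₗ W.subtype) := by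
  ext ψ
  constructor
  · rintro ⟨⟨w, hw, rfl⟩, dψ, h1, h2⟩
    refine ⟨⟨w, hw⟩, mem_recipEigenspace_gramOperator.2 fun v => ?_, rfl⟩
    have := h2 (K v) ⟨v, v.2, rfl⟩ v (hd v (hW v.2))
    rwa [h1.unique (hd w (hW hw))] at this
  · rintro ⟨w, hw, rfl⟩
    rw [SetLike.mem_coe, mem_recipEigenspace_gramOperator] at hw
    refine ⟨⟨w, w.2, rfl⟩, w, hd w (hW w.2), ?_⟩
    rintro _ ⟨v, hv, rfl⟩ dv hdv
    rw [hdv.unique (hd v (hW hv))]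
    exact hw ⟨v, hv⟩

lemma isNthEigenvalue_map_iff (hd : ∀ f ∈ K.kerᗮ, HasWeakDeriv (K f) f) (hW : W ≤ K.kerᗮ)
    (l : ℕ) (μ : ℝ) :
    IsNthEigenvalue (W.map (K : L2 a b →ₗ[ℝ] L2 a b)) l μ ↔
      IsNthRecipEigenvalue (gramOperator K W) l μ := by
  have h : ∀ s : ℝ → Prop,
      Module.rank ℝ ↥(⨆ (ν : ℝ) (_ : s ν), eigenspace (W.map (K : L2 a b →ₗ[ℝ] L2 a b)) ν) =
        Module.rank ℝ ↥(⨆ (ν : ℝ) (_ : s ν), recipEigenspace (gramOperator K W) ν) := by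
    intro s
    have h1 : (⨆ (ν : ℝ) (_ : s ν), eigenspace (W.map (K : L2 a b →ₗ[ℝ] L2 a b)) ν) =
        (⨆ (ν : ℝ) (_ : s ν), recipEigenspace (gramOperator K W) ν).map
          ((K : L2 a b →ₗ[ℝ] L2 a b) ∘ₗ W.subtype) := by
      simp only [eigenspace_map hd hW, Submodule.map_iSup]
    rw [h1]
    exact (Submodule.equivMapOfInjective _ (injective_comp_subtype hW) _).rank_eq.symm
  rw [IsNthEigenvalue, IsNthRecipEigenvalue, h, h]

/-- Exhibits the exact problem as the case `W = (ker K)ᗮ` of the reduction. -/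
lemma map_orthogonal_ker (K : L2 a b →L[ℝ] L2 a b) :
    (K.kerᗮ).map (K : L2 a b →ₗ[ℝ] L2 a b) = K.range := by
  apply le_antisymm (LinearMap.map_le_range)
  rintro _ ⟨f, rfl⟩
  obtain ⟨y, hy, z, hz, rfl⟩ := K.ker.exists_add_mem_mem_orthogonal f
  have h0 : K y = 0 := hy
  exact ⟨z, hz, by simp [h0]⟩

end Gram

end OutlierFree

/-! ### Singular vectors -/

namespace OutlierFree

variable {a b : ℝ}

section SingularSpaces

variable {K : L2 a b →L[ℝ] L2 a b}

/-- The span of the right singular vectors of `K` whose reciprocal squared singular value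
satisfies `s`. -/
noncomputable def singularSpace (K : L2 a b →L[ℝ] L2 a b) (s : ℝ → Prop) :
    Submodule ℝ (L2 a b) :=
  (⨆ (ν : ℝ) (_ : s ν), recipEigenspace (gramOperator K K.kerᗮ) ν).map K.kerᗮ.subtype

lemma singularSpace_le (s : ℝ → Prop) : singularSpace K s ≤ K.kerᗮ :=
  Submodule.map_subtype_le _ _

lemma rank_singularSpace (s : ℝ → Prop) : Module.rank ℝ (singularSpace K s) =
    Module.rank ℝ ↥(⨆ (ν : ℝ) (_ : s ν), recipEigenspace (gramOperator K K.kerᗮ) ν) :=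
  (Submodule.equivMapOfInjective _ K.kerᗮ.injective_subtype _).rank_eq.symm

/-- The range of `K*` already lies in `(ker K)ᗮ`, so compressing `K* K` to that space changes
nothing. -/
lemma adjoint_comp_eq_gramOperator (w : (K.ker)ᗮ) :
    ContinuousLinearMap.adjoint K (K w) = gramOperator K K.kerᗮ w := by
  have h1 : ContinuousLinearMap.adjoint K (K w) ∈ K.kerᗮ := by
    intro v hv
    have h0 : K v = 0 := hv
    rw [ContinuousLinearMap.adjoint_inner_right, h0, inner_zero_left]
  have h2 : (⟨_, h1⟩ : (K.ker)ᗮ) = gramOperator K K.kerᗮ w := by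
    refine ext_inner_right ℝ fun v => ?_
    rw [inner_gramOperator, Submodule.coe_inner, ContinuousLinearMap.adjoint_inner_left]
  exact congrArg Subtype.val h2

lemma norm_map_sub_starProjection_singularSpace_le (hK : IsCompactOperator K) {m : ℝ}
    (hm : 0 < m) [FiniteDimensional ℝ (singularSpace K (· < m))] (g : L2 a b) :
    ‖K (g - (singularSpace K (· < m)).starProjection g)‖ ≤ (√m)⁻¹ * ‖g‖ := by
  set F := singularSpace K (· < m) with hF
  -- `g` is arbitrary; its part `y` in `ker K` is dropped, and `z` stays orthogonal to `F` because
  -- `F ≤ (ker K)ᗮ`.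
  obtain ⟨y, hy, z, hz, hyz⟩ := K.ker.exists_add_mem_mem_orthogonal (g - F.starProjection g)
  have hKy : K y = 0 := hy
  have hz' : (⟨z, hz⟩ : (K.ker)ᗮ) ∈
      (⨆ (ν : ℝ) (_ : ν < m), recipEigenspace (gramOperator K K.kerᗮ) ν)ᗮ := by
    intro x hx
    have hxF : (x : L2 a b) ∈ F := ⟨x, hx, rfl⟩
    have h1 : ⟪(x : L2 a b), y⟫_ℝ = 0 := by
      rw [real_inner_comm]
      exact x.2 y hy
    have h2 : ⟪(x : L2 a b), g - F.starProjection g⟫_ℝ = 0 := by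
      rw [real_inner_comm]
      exact F.starProjection_inner_eq_zero g _ hxF
    rw [hyz, inner_add_right, h1, zero_add] at h2
    exact h2
  have h1 := mul_inner_le_of_mem_orthogonal isPositive_gramOperator
    (isCompactOperator_gramOperator hK) m hz'
  rw [inner_gramOperator, real_inner_self_eq_norm_sq] at h1
  have h2 : ‖z‖ ^ 2 ≤ ‖g‖ ^ 2 := by
    have h3 : ‖g - F.starProjection g‖ ≤ ‖g‖ := by
      simpa using norm_sub_starProjection_le F g F.zero_mem
    have h4 : ‖y + z‖ ^ 2 = ‖y‖ ^ 2 + ‖z‖ ^ 2 := by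
      rw [norm_add_sq_real, hz y hy]
      ring
    have h5 : ‖y + z‖ ^ 2 ≤ ‖g‖ ^ 2 := by
      rw [← hyz]
      gcongr
    nlinarith [sq_nonneg ‖y‖]
  rw [hyz, map_add, hKy, zero_add, le_inv_mul_iff₀ (Real.sqrt_pos.2 hm)]
  refine abs_le_of_sq_le_sq' ?_ (norm_nonneg _) |>.2
  rw [mul_pow, Real.sq_sqrt hm.le]
  exact h1.trans h2

lemma norm_le_norm_map_of_mem_singularSpace {m : ℝ} (hm : 0 < m) {f : L2 a b}
    (hf : f ∈ singularSpace K (· ≤ m)) : (√m)⁻¹ * ‖f‖ ≤ ‖K f‖ := by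
  obtain ⟨w, hw, rfl⟩ := hf
  have h1 := norm_sq_le_of_mem_iSup isPositive_gramOperator m hw
  rw [inner_gramOperator, real_inner_self_eq_norm_sq] at h1
  rw [inv_mul_le_iff₀ (Real.sqrt_pos.2 hm)]
  refine abs_le_of_sq_le_sq' ?_ (by positivity) |>.2
  rw [mul_pow, Real.sq_sqrt hm.le]
  exact h1

/-- From `‖Kf‖² = (K*Kf, f) ≤ ‖K*Kf‖ ‖f‖` and the lower bound for `K` at `f`. -/
lemma norm_le_norm_adjoint_of_mem_map_singularSpace {m : ℝ} (hm : 0 < m) {u : L2 a b}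
    (hu : u ∈ (singularSpace K (· ≤ m)).map (K : L2 a b →ₗ[ℝ] L2 a b)) :
    (√m)⁻¹ * ‖u‖ ≤ ‖ContinuousLinearMap.adjoint K u‖ := by
  obtain ⟨f, hf, rfl⟩ := hu
  rw [ContinuousLinearMap.coe_coe]
  set A := ContinuousLinearMap.adjoint K (K f) with hA
  have h1 := norm_le_norm_map_of_mem_singularSpace hm hf
  have h2 : ‖K f‖ * ‖K f‖ ≤ ‖A‖ * ‖f‖ := by
    rw [← real_inner_self_eq_norm_mul_norm, ← ContinuousLinearMap.adjoint_inner_left]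
    exact real_inner_le_norm _ _
  have hs : 0 < √m := Real.sqrt_pos.2 hm
  rw [inv_mul_le_iff₀ hs] at h1 ⊢
  rcases (norm_nonneg (K f)).eq_or_lt with h0 | h0
  · rw [← h0]
    positivity
  · refine le_of_mul_le_mul_right ?_ h0
    calc ‖K f‖ * ‖K f‖ ≤ ‖A‖ * ‖f‖ := h2
      _ ≤ ‖A‖ * (√m * ‖K f‖) := by gcongr
      _ = _ := by ring

lemma exists_adjoint_eq_of_mem_singularSpace (s : ℝ → Prop) {f : L2 a b}
    (hf : f ∈ singularSpace K s) :
    ∃ u ∈ (singularSpace K s).map (K : L2 a b →ₗ[ℝ] L2 a b),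
      ContinuousLinearMap.adjoint K u = f := by
  obtain ⟨w, hw, rfl⟩ := hf
  obtain ⟨v, hv, rfl⟩ := exists_map_eq_of_mem_iSup_recipEigenspace s hw
  exact ⟨K v, ⟨v, ⟨v, hv, rfl⟩, rfl⟩, adjoint_comp_eq_gramOperator v⟩

end SingularSpaces

/-! ### Two-sided eigenvalue bounds -/

/-- The Galerkin eigenvalue bound for a trial space `K(W)` whose defect on the first singular
vectors is at most `δ`. -/
lemma le_div_of_norm_map_sub_le {K : L2 a b →L[ℝ] L2 a b} (hK : IsCompactOperator K)
    {W : Submodule ℝ (L2 a b)} [FiniteDimensional ℝ W] {l : ℕ} {m δ : ℝ} (hm : 0 < m)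
    (hδ : δ < 1)
    (hl : (l : Cardinal) ≤ Module.rank ℝ (singularSpace K (· ≤ m)))
    (hW : ∀ e ∈ singularSpace K (· ≤ m), ‖K (e - W.starProjection e)‖ ≤ δ * ‖K e‖) :
    (l : Cardinal) ≤ Module.rank ℝ W ∧ ∀ μ, IsNthRecipEigenvalue (gramOperator K W) l μ →
      μ ≤ m / (1 - δ) ^ 2 := by
  set S := singularSpace K (· ≤ m) with hS
  have hδ' : 0 < 1 - δ := by linarith
  have hlow : ∀ e ∈ S, (1 - δ) * ‖K e‖ ≤ ‖K (W.starProjection e)‖ := by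
    intro e he
    have h1 := hW e he
    rw [map_sub] at h1
    linarith [norm_sub_norm_le (K e) (K (W.starProjection e))]
  -- The range of `φ` is the trial space for min-max; `hlow` and `δ < 1` keep its dimension at least
  -- `l`.
  let φ : S →ₗ[ℝ] W := (W.orthogonalProjectionOnto : L2 a b →ₗ[ℝ] W) ∘ₗ S.subtype
  have hφ : Function.Injective φ := by
    rw [injective_iff_map_eq_zero]
    intro e he
    have h0 : W.starProjection (e : L2 a b) = 0 := congrArg Subtype.val he
    have h1 := hlow e e.2
    rw [h0, map_zero, norm_zero] at h1
    have h2 : ‖K e‖ ≤ 0 := nonpos_of_mul_nonpos_right h1 hδ'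
    have h3 := (norm_le_norm_map_of_mem_singularSpace hm e.2).trans h2
    have h4 : ‖(e : L2 a b)‖ ≤ 0 :=
      nonpos_of_mul_nonpos_right h3 (inv_pos.2 (Real.sqrt_pos.2 hm))
    exact Subtype.ext (norm_le_zero_iff.1 h4)
  refine ⟨hl.trans (LinearMap.rank_le_of_injective φ hφ), fun μ hμ => ?_⟩
  refine hμ.le_of_forall_mem isPositive_gramOperator (isCompactOperator_gramOperator hK)
    (G := LinearMap.range φ) (hl.trans (LinearEquiv.ofInjective φ hφ).rank_eq.le) ?_
  rintro _ ⟨e, rfl⟩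
  rw [inner_gramOperator, real_inner_self_eq_norm_sq]
  change ‖W.starProjection (e : L2 a b)‖ ^ 2 ≤ _ * ‖K (W.starProjection (e : L2 a b))‖ ^ 2
  have h1 : ‖W.starProjection (e : L2 a b)‖ ≤ ‖(e : L2 a b)‖ := W.norm_starProjection_apply_le _
  have h2 := norm_le_norm_map_of_mem_singularSpace hm e.2
  rw [inv_mul_le_iff₀ (Real.sqrt_pos.2 hm)] at h2
  have h3 := hlow e e.2
  calc ‖W.starProjection (e : L2 a b)‖ ^ 2 ≤ (√m * ‖K e‖) ^ 2 := by
        gcongr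
        exact h1.trans h2
    _ = m / (1 - δ) ^ 2 * ((1 - δ) * ‖K e‖) ^ 2 := by
        rw [mul_pow, Real.sq_sqrt hm.le]
        field_simp
    _ ≤ _ := by gcongr

/-- Galerkin reciprocal eigenvalues lie above the exact ones. -/
lemma le_of_isNthRecipEigenvalue {K : L2 a b →L[ℝ] L2 a b} (hK : IsCompactOperator K)
    {W : Submodule ℝ (L2 a b)} [CompleteSpace W] (hW : W ≤ K.kerᗮ) {l : ℕ} {μ μ' : ℝ}
    (hμ : IsNthRecipEigenvalue (gramOperator K K.kerᗮ) l μ)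
    (hμ' : IsNthRecipEigenvalue (gramOperator K W) l μ') : μ ≤ μ' := by
  set G := ⨆ (ν : ℝ) (_ : ν ≤ μ'), recipEigenspace (gramOperator K W) ν with hG
  refine hμ.le_of_forall_mem isPositive_gramOperator (isCompactOperator_gramOperator hK)
    (G := G.map (Submodule.inclusion hW)) ?_ ?_
  · exact hμ'.2.trans
      (Submodule.equivMapOfInjective _ (Submodule.inclusion_injective hW) G).rank_eq.le
  · rintro _ ⟨g, hg, rfl⟩
    have h1 := norm_sq_le_of_mem_iSup isPositive_gramOperator μ' hg
    rw [inner_gramOperator] at h1 ⊢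
    exact h1

/-- Approximating `e` in `𝕐_q` gives `q + 1` factors; applying `K` to the error gives one more. -/
lemma norm_map_sub_starProjection_galerkinSpace_le {K : L2 a b →L[ℝ] L2 a b}
    {X₀ Y₀ : Submodule ℝ (L2 a b)} [FiniteDimensional ℝ X₀] [FiniteDimensional ℝ Y₀] {m M : ℝ}
    (hm : 0 < m) (hX : ApproximatesRange K X₀ (√M)⁻¹)
    (hY : ApproximatesRange (ContinuousLinearMap.adjoint K) Y₀ (√M)⁻¹) (q : ℕ)
    {e : L2 a b} (he : e ∈ singularSpace K (· ≤ m)) :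
    ‖K (e - (galerkinSpace (ContinuousLinearMap.adjoint K) Y₀ X₀ q).starProjection e)‖ ≤
      (√(m / M)) ^ (q + 2) * ‖K e‖ := by
  have hσ : (0 : ℝ) ≤ (√M)⁻¹ := by positivity
  have hc : 0 < (√m)⁻¹ := inv_pos.2 (Real.sqrt_pos.2 hm)
  have hX' : ApproximatesRange (ContinuousLinearMap.adjoint (ContinuousLinearMap.adjoint K))
      X₀ (√M)⁻¹ := by rwa [ContinuousLinearMap.adjoint_adjoint]
  have hquot : (√M)⁻¹ / (√m)⁻¹ = √(m / M) := by
    rw [Real.sqrt_div hm.le, div_inv_eq_mul, div_eq_inv_mul]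
  have h1 := norm_sub_starProjection_galerkinSpace_le hσ hc (ContinuousLinearMap.adjoint K) Y₀ X₀
    (singularSpace K (· ≤ m)) ((singularSpace K (· ≤ m)).map (K : L2 a b →ₗ[ℝ] L2 a b)) hY hX'
    (fun u hu => exists_adjoint_eq_of_mem_singularSpace _ hu)
    (by
      rw [ContinuousLinearMap.adjoint_adjoint]
      exact fun f hf => hf)
    (fun u hu => norm_le_norm_adjoint_of_mem_map_singularSpace hm hu)
    (by
      rw [ContinuousLinearMap.adjoint_adjoint]
      exact fun f hf => norm_le_norm_map_of_mem_singularSpace hm hf) q he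
  have h2 := (approximatesRange_galerkinSpace hσ (ContinuousLinearMap.adjoint K) Y₀ X₀ hY hX'
    q).norm_adjoint_le e
  rw [ContinuousLinearMap.adjoint_adjoint] at h2
  have h3 := norm_le_norm_map_of_mem_singularSpace hm he
  rw [hquot] at h1
  calc _ ≤ _ := h2
    _ ≤ (√M)⁻¹ * ((√(m / M)) ^ (q + 1) * ‖e‖) := by gcongr
    _ = (√(m / M)) ^ (q + 1) * (√(m / M) * ((√m)⁻¹ * ‖e‖)) := by
      rw [← hquot]
      field_simp
    _ ≤ (√(m / M)) ^ (q + 1) * (√(m / M) * ‖K e‖) := by gcongr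
    _ = _ := by ring

end OutlierFree

theorem mainTheorem5 (a b : ℝ) (hab : a < b)
    -- the integral operator `K` and its kernel
    (k : ℝ → ℝ → ℝ) (hk : IsL2Kernel a b k)
    (K : L2 a b →L[ℝ] L2 a b) (hK : K = integralOperator k hk)
    -- `∂K = I` on `A_*^r` and `∂K* = -I` on `A^r`, for all `r ≥ 0`
    (hdK : ∀ r : ℕ, ∀ f ∈ functionClass (ContinuousLinearMap.adjoint K) r,
      HasWeakDeriv (K f) f)
    (hdK' : ∀ r : ℕ, ∀ g ∈ functionClass K r,
      HasWeakDeriv (ContinuousLinearMap.adjoint K g) (-g))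
    -- the initial spaces
    (X₀ Y₀ : Submodule ℝ (L2 a b)) [FiniteDimensional ℝ X₀] [FiniteDimensional ℝ Y₀]
    (hX₀ : X₀ ⟂ (ContinuousLinearMap.adjoint K).ker)
    (hY₀ : Y₀ ⟂ K.ker)
    (n : ℕ)
    (hX₀opt : IsOptimal n (functionClass K 1) X₀)
    (hY₀opt : IsOptimal n (functionClass (ContinuousLinearMap.adjoint K) 1) Y₀)
    -- the first `n + 1` eigenvalues of the problem posed in `K(L²(a, b))`
    (μ : ℕ → ℝ)
    (hμ : ∀ l : ℕ, 1 ≤ l → l ≤ n + 1 →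
      IsNthEigenvalue (K.range) l (μ l))
    (hgap : μ n < μ (n + 1))
    (p : ℕ) (hp : 1 ≤ p) (l : ℕ) (hl : 1 ≤ l) (hln : l ≤ n) :
    (∃ μp : ℝ, IsNthEigenvalue (galerkinSpace K X₀ Y₀ p) l μp) ∧
    ∀ μp : ℝ, IsNthEigenvalue (galerkinSpace K X₀ Y₀ p) l μp →
      μ l ≤ μp ∧
      μp ≤ μ l / (1 - (μ l / μ (n + 1)) ^ (((p : ℝ) + 1) / 2)) ^ 2 := by
  have hcomp : IsCompactOperator K := hK ▸ isCompactOperator_integralOperator hk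
  have hd : ∀ f ∈ K.kerᗮ, HasWeakDeriv (K f) f := by
    -- The hypothesis at `r = 0` covers the unit ball of `(ker K)ᗮ`; scaling extends it.
    intro f hf
    rcases eq_or_ne f 0 with rfl | hf0
    · rw [map_zero]
      exact HasWeakDeriv.zero
    have hn : ‖f‖ ≠ 0 := norm_ne_zero_iff.2 hf0
    have h1 := hdK 0 (‖f‖⁻¹ • f) ⟨by rw [norm_smul, norm_inv, norm_norm, inv_mul_cancel₀ hn], by
      rw [ContinuousLinearMap.adjoint_adjoint]
      exact Submodule.smul_mem _ _ hf⟩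
    simpa [smul_smul, hn] using h1.smul ‖f‖
  have hμ' : ∀ j : ℕ, 1 ≤ j → j ≤ n + 1 →
      IsNthRecipEigenvalue (gramOperator K K.kerᗮ) j (μ j) := by
    intro j h1 h2
    rw [← isNthEigenvalue_map_iff hd le_rfl, map_orthogonal_ker]
    exact hμ j h1 h2
  have hμl := hμ' l hl (by omega)
  have hμn := hμ' n (by omega) (by omega)
  have hμn1 := hμ' (n + 1) (by omega) le_rfl
  have hlpos : 0 < μ l := hμl.pos isPositive_gramOperator hl
  have hlt : μ l < μ (n + 1) := (hμl.mono hln hμn).trans_lt hgap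
  have hMpos : 0 < μ (n + 1) := hlpos.trans hlt
  -- the first `n` singular vectors give spaces with the optimal error
  have hrank : Module.rank ℝ (singularSpace K (· < μ (n + 1))) = n :=
    (rank_singularSpace _).trans (rank_iSup_recipEigenspace_of_lt hgap hμn hμn1)
  have hfin : FiniteDimensional ℝ (singularSpace K (· < μ (n + 1))) :=
    Module.rank_lt_aleph0_iff.1 (hrank ▸ Cardinal.natCast_lt_aleph0)
  have hfinrank : Module.finrank ℝ (singularSpace K (· < μ (n + 1))) = n :=
    Module.finrank_eq_of_rank_eq hrank
  have hF := norm_map_sub_starProjection_singularSpace_le hcomp hMpos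
  have hσ : (0 : ℝ) ≤ (√(μ (n + 1)))⁻¹ := by positivity
  have hY : ApproximatesRange (ContinuousLinearMap.adjoint K) Y₀ (√(μ (n + 1)))⁻¹ :=
    hY₀opt.approximatesRange hσ hfinrank (ApproximatesRange.of_norm_map_le hF)
  -- The competitor is the space of left singular vectors, of dimension `n` because `K` is injective
  -- on `(ker K)ᗮ`.
  have hX : ApproximatesRange K X₀ (√(μ (n + 1)))⁻¹ := by
    refine hX₀opt.approximatesRange hσ
      (Y := (singularSpace K (· < μ (n + 1))).map (K : L2 a b →ₗ[ℝ] L2 a b)) ?_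
      ((ApproximatesRange.of_norm_map_le hF).map hσ)
    have hinj : Function.Injective
        ((K : L2 a b →ₗ[ℝ] L2 a b).domRestrict (singularSpace K (· < μ (n + 1)))) :=
      injective_comp_subtype (singularSpace_le _)
    rw [← LinearMap.range_domRestrict]
    exact (LinearMap.finrank_range_of_inj hinj).trans hfinrank
  -- the Galerkin problem
  obtain ⟨q, rfl⟩ : ∃ q, p = q + 1 := ⟨p - 1, by omega⟩
  set W := galerkinSpace (ContinuousLinearMap.adjoint K) Y₀ X₀ q with hWdef
  have hV : galerkinSpace K X₀ Y₀ (q + 1) = W.map (K : L2 a b →ₗ[ℝ] L2 a b) := rfl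
  have hW : W ≤ K.kerᗮ := by
    have h1 := galerkinSpace_le_orthogonal_ker (ContinuousLinearMap.adjoint K) (X₀ := Y₀) X₀
      (by rwa [ContinuousLinearMap.adjoint_adjoint]) q
    rwa [ContinuousLinearMap.adjoint_adjoint] at h1
  set δ := (μ l / μ (n + 1)) ^ ((((q + 1 : ℕ) : ℝ) + 1) / 2) with hδdef
  have hratio : 0 ≤ μ l / μ (n + 1) := by positivity
  -- With `p = q + 1`, the exponent `(p + 1)/2` is `q + 2` powers of the square root.
  have hδ : δ = √(μ l / μ (n + 1)) ^ (q + 2) := by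
    rw [hδdef, Real.sqrt_eq_rpow, ← Real.rpow_natCast, ← Real.rpow_mul hratio]
    congr 1
    push_cast
    ring
  have hδ1 : δ < 1 := Real.rpow_lt_one hratio ((div_lt_one hMpos).2 hlt) (by positivity)
  obtain ⟨hdim, hupper⟩ := le_div_of_norm_map_sub_le hcomp (W := W) hlpos hδ1
    (hμl.2.trans (rank_singularSpace _).ge) fun e he => by
      rw [hδ]
      exact norm_map_sub_starProjection_galerkinSpace_le hlpos hX hY q he
  rw [hV]
  simp_rw [isNthEigenvalue_map_iff hd hW]
  -- Existence needs `l ≤ dim W`, which the injective projection of the singular vectors provides.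
  refine ⟨exists_isNthRecipEigenvalue isPositive_gramOperator (injective_gramOperator hW) hl ?_,
    fun μp hμp => ⟨le_of_isNthRecipEigenvalue hcomp hW hμl hμp, hupper μp hμp⟩⟩
  rw [← Module.finrank_eq_rank] at hdim
  exact_mod_cast hdim
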